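/- Let $\mathfrak g$ be a complex Lie algebra of finite dimension $n$. Put $C^1\mathfrak g=\mathfrak g$ and $C^k\mathfrak g=[C^{k-1}\mathfrak g,\mathfrak g]$ for $k\ge 2$. Call $\mathfrak g$ *filiform* if $\dim C^k\mathfrak g=n-k$ for $2\le k\le n$. A basis $e_1,\dots,e_n$ of $\mathfrak g$ is *adapted* if $$[e_1,e_h]=e_{h-1}\ (3\le h\le n),\qquad [e_2,e_h]=0\ (1\le h\le n),\qquad [e_3,e_h]=0\ (2\le h\le n).$$ A filiform Lie algebra is *model* if it has an adapted basis in which $[e_i,e_j]=0$ for all $i,j\ge 2$. For a non-model filiform Lie algebra $\mathfrak g$ let $$z_1=\max\{k\le n+1 : C_{\mathfrak g}(C^{n-k+2}\mathfrak g)\supsetneq C^2\mathfrak g\},\qquad z_2=\max\{k\le n : C^{n-k+1}\mathfrak g\text{ is abelian}\},$$ where $C_{\mathfrak g}(\cdot)$ denotes the centralizer in $\mathfrak g$; say that $\mathfrak g$ has associated triple $(z_1,z_2,n)$. For a basis $e_1,\dots,e_n$ let $P_h(u)$ be the coordinate of $u\in\mathfrak g$ at $e_h$, with the convention $e_h=0$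 and $P_h=0$ for $h>n$. **Theorem.** Let $\mathfrak g$ be an $n$-dimensional non-model filiform complex Lie algebra with associated triple $(z_1,z_2,n)$. Then there exist an adapted basis $e_1,\dots,e_n$ of $\mathfrak g$ and complex numbers $\alpha_i$ ($1\le i\le z_2-z_1+1$), $\gamma_j$ ($1\le j\le n-z_2-1$) and $\beta_{k\ell}$ ($2\le \ell\le n-z_2$, $1\le k<z_2-z_1+\ell$) such that $$[e_1,e_h]=e_{h-1}\quad\text{for }3\le h\le n,$$ $$[e_{z_1+i},e_{z_2+1}]=\alpha_1e_{i+2}+\alpha_2e_{i+1}+\cdots+\alpha_{i+1}e_2\quad\text{for }0\le i\le z_2-z_1,$$ $$[e_{z_1},e_{z_2+j}]=\alpha_1e_{j+1}+\gamma_1e_j+\cdots+\gamma_{j-1}e_2\quad\text{for }2\le j\le n-z_2,$$ $$[e_{z_1+k},e_{z_2+\ell}]=\sum_{h=2}^{k+\ell}P_h\bigl([e_{z_1+k-1},e_{z_2+\ell}]+[e_{z_1+k},e_{z_2+\ell-1}]\bigr)e_{h+1}+\beta_{k\ell}\,e_2\quad\text{for }2\le\ell\le n-z_2,\ 1\le k<z_2-z_1+\ell,$$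 and all brackets $[e_i,e_j]$ with $i<j$ not listed here are zero; that is, $[e_1,e_2]=0$ and $[e_i,e_j]=0$ whenever $2\le i<j\le n$ and ($i<z_1$ or $j\le z_2$). -/

import Mathlib

open Module

namespace FiliformLie

noncomputable section

/-- The lower central series numbered from one: `C^1 L = L` and `C^k L = [C^(k-1) L, L]`.
It is only used for `k ≥ 1`. -/
def C (L : Type*) [LieRing L] [LieAlgebra ℂ L] (k : ℕ) : LieIdeal ℂ L :=
  LieModule.lowerCentralSeries ℂ L L (k - 1)

/-- `L`, of dimension `n`, is filiform: `dim C^k L = n - k` for `2 ≤ k ≤ n`. -/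
def IsFiliform (L : Type*) [LieRing L] [LieAlgebra ℂ L] : Prop :=
  ∀ k : ℕ, 2 ≤ k → k ≤ finrank ℂ L → finrank ℂ (C L k) = finrank ℂ L - k

/-- The basis vector `e_h`, for `1 ≤ h ≤ n`; by convention `e_h = 0` for all other `h`. -/
def vec {L : Type*} [LieRing L] [LieAlgebra ℂ L] {n : ℕ}
    (b : Basis (Set.Icc 1 n) ℂ L) (h : ℕ) : L :=
  if hh : h ∈ Set.Icc 1 n then b ⟨h, hh⟩ else 0

/-- The coordinate map `P_h : L → ℂ` relative to `e_h`, for `1 ≤ h ≤ n`;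
by convention `P_h = 0` for all other `h`. -/
def P {L : Type*} [LieRing L] [LieAlgebra ℂ L] {n : ℕ}
    (b : Basis (Set.Icc 1 n) ℂ L) (h : ℕ) : L →ₗ[ℂ] ℂ :=
  if hh : h ∈ Set.Icc 1 n then b.coord ⟨h, hh⟩ else 0

/-- The basis `e_1, …, e_n` is adapted. -/
structure IsAdapted {L : Type*} [LieRing L] [LieAlgebra ℂ L] {n : ℕ}
    (b : Basis (Set.Icc 1 n) ℂ L) : Prop where
  one_left : ∀ h : ℕ, 3 ≤ h → h ≤ n → ⁅vec b 1, vec b h⁆ = vec b (h - 1)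
  two_left : ∀ h : ℕ, 1 ≤ h → h ≤ n → ⁅vec b 2, vec b h⁆ = 0
  three_left : ∀ h : ℕ, 2 ≤ h → h ≤ n → ⁅vec b 3, vec b h⁆ = 0

/-- A (filiform) Lie algebra is model when, in some adapted basis, the only nonzero brackets are
`[e_1, e_h] = e_(h-1)`, `3 ≤ h ≤ n`. -/
def IsModel (L : Type*) [LieRing L] [LieAlgebra ℂ L] : Prop :=
  ∃ b : Basis (Set.Icc 1 (finrank ℂ L)) ℂ L, IsAdapted b ∧
    ∀ i j : ℕ, 2 ≤ i → i ≤ finrank ℂ L → 2 ≤ j → j ≤ finrank ℂ L → ⁅vec b i, vec b j⁆ = 0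

/-- The centralizer in `L` of an ideal `H`, as a set. -/
def centralizer {L : Type*} [LieRing L] [LieAlgebra ℂ L] (H : LieIdeal ℂ L) : Set L :=
  {x | ∀ y ∈ H, ⁅x, y⁆ = 0}

/-- The invariant `z₁`: the largest `k` such that the centralizer of `C^(n-k+2) L` strictly
contains `C^2 L`. The condition `k ≤ n + 1` says that the index `n - k + 2` is at least one. -/
def z₁ (L : Type*) [LieRing L] [LieAlgebra ℂ L] : ℕ :=
  sSup {k : ℕ | k ≤ finrank ℂ L + 1 ∧
    (C L 2 : Set L) ⊂ centralizer (C L (finrank ℂ L + 2 - k))}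

/-- The invariant `z₂`: the largest `k` such that `C^(n-k+1) L` is abelian.
The condition `k ≤ n` says that the index `n - k + 1` is at least one. -/
def z₂ (L : Type*) [LieRing L] [LieAlgebra ℂ L] : ℕ :=
  sSup {k : ℕ | k ≤ finrank ℂ L ∧ IsLieAbelian (C L (finrank ℂ L + 1 - k))}

end

end FiliformLie

/-!
The basis is built from its last vector. By definition of `z₁` there is a vector `e_n` outside
`C^2` that centralizes `C^(n-z₁+2)`. For `2 ≤ k ≤ n - 2` the elements `x` with
`⁅x, C^k⁆ ⊆ C^(k+2)` form a proper subspace, as do those with `⁅x, e_n⁆ ∈ C^3`, and finitely many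
proper subspaces do not cover the algebra. So there is an `e_1` outside all of them, and
`e_(h-1) = ⁅e_1, e_h⁆` defines a basis in which `e_h ∈ C^(n+1-h)` for `h ≥ 2`
(`IsFiliform.exists_generic`, `IsFiliform.exists_basis`).

In this basis `⁅e_i, e_j⁆ = 0` for `i, j ≥ 2` as soon as `i < z₁` (by the choice of `e_n`, and
because `C^2` lies in the centralizer) or `i, j ≤ z₂` (because `C^(n-z₂+1)` is abelian); see
`IsFiliform.exists_basis_lie_eq_zero`. Moreover `4 ≤ z₁ ≤ z₂ < n`: the first inequality makes the
basis adapted, and `z₁ < n`, on which `z₁ ≤ z₂` depends, holds because the algebra is not model.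

The brackets that remain are governed by the Jacobi identity with `e_1`,
`⁅e_1, ⁅e_i, e_j⁆⁆ = ⁅e_(i-1), e_j⁆ + ⁅e_i, e_(j-1)⁆`. Since `ad e_1` lowers the indices of the
coordinates by one (`P_lie_vec_one`) and brackets have no `e_1`-coordinate, this identity determines
`⁅e_i, e_j⁆` up to a multiple of `e_2`. Where one of the two terms on the right vanishes (`j = z₂ + 1`
or `i = z₁`) the coordinates are constant along diagonals (`eq_sum_of_lie_succ_eq`); in general the
number of nonzero coordinates grows by at most one at each step (`P_lie_eq_zero`).
-/

namespace FiliformLie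

/-! ### The lower central series -/

section LowerCentralSeries

variable {L : Type*} [LieRing L] [LieAlgebra ℂ L]

lemma mem_C_one (x : L) : x ∈ C L 1 := by
  simp [C]

lemma C_antitone {i j : ℕ} (h : i ≤ j) : C L j ≤ C L i :=
  LieModule.antitone_lowerCentralSeries ℂ L L (Nat.sub_le_sub_right h 1)

lemma C_succ {k : ℕ} (hk : 1 ≤ k) : C L (k + 1) = ⁅(⊤ : LieIdeal ℂ L), C L k⁆ := by
  obtain ⟨k, rfl⟩ := Nat.exists_eq_add_of_le' hk
  simp [C, LieModule.lowerCentralSeries_succ]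

lemma lie_mem_C {k : ℕ} (hk : 1 ≤ k) (x : L) {y : L} (hy : y ∈ C L k) : ⁅x, y⁆ ∈ C L (k + 1) := by
  rw [C_succ hk]
  exact LieSubmodule.lie_mem_lie (LieSubmodule.mem_top x) hy

/-- Bracketing on the left with an element of an ideal of the series also raises the index. -/
lemma lie_mem_C' {k : ℕ} (hk : 1 ≤ k) (x : L) {y : L} (hy : y ∈ C L k) : ⁅y, x⁆ ∈ C L (k + 1) := by
  rw [← lie_skew]
  exact neg_mem (lie_mem_C hk x hy)

lemma C_succ_le {k : ℕ} (hk : 1 ≤ k) {N : Submodule ℂ L}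
    (h : ∀ x : L, ∀ y ∈ C L k, ⁅x, y⁆ ∈ N) : (C L (k + 1)).toSubmodule ≤ N := by
  rw [C_succ hk, LieSubmodule.lieIdeal_oper_eq_linear_span', Submodule.span_le]
  rintro _ ⟨x, -, y, hy, rfl⟩
  exact h x y hy

end LowerCentralSeries

lemma sup_span_singleton_eq {V : Type*} [AddCommGroup V] [Module ℂ V] [FiniteDimensional ℂ V]
    {N M : Submodule ℂ V} (hNM : N ≤ M) {a : V} (haM : a ∈ M) (haN : a ∉ N)
    (hdim : finrank ℂ M ≤ finrank ℂ N + 1) : N ⊔ Submodule.span ℂ {a} = M := by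
  refine Submodule.eq_of_le_of_finrank_le
    (sup_le hNM ((Submodule.span_singleton_le_iff_mem _ _).2 haM)) (hdim.trans ?_)
  refine Submodule.finrank_lt_finrank_of_lt (lt_of_le_of_ne le_sup_left fun h => haN ?_)
  rw [h]
  exact Submodule.mem_sup_right (Submodule.mem_span_singleton_self a)

/-! ### Generic elements of filiform Lie algebras -/

section Filiform

variable {L : Type*} [LieRing L] [LieAlgebra ℂ L] [FiniteDimensional ℂ L]

namespace IsFiliform

lemma C_eq_bot (hfil : IsFiliform L) (hn : 2 ≤ finrank ℂ L) : C L (finrank ℂ L) = ⊥ := by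
  have h := hfil _ hn le_rfl
  rw [Nat.sub_self] at h
  rw [← LieSubmodule.toSubmodule_eq_bot]
  exact Submodule.finrank_eq_zero.1 h

lemma not_C_le_succ (hfil : IsFiliform L) {k : ℕ} (hk : 2 ≤ k) (hkn : k + 1 ≤ finrank ℂ L) :
    ¬ (C L k).toSubmodule ≤ (C L (k + 1)).toSubmodule := by
  intro h
  have h1 : finrank ℂ (C L k) ≤ finrank ℂ (C L (k + 1)) := Submodule.finrank_mono h
  rw [hfil k hk (by omega), hfil (k + 1) (by omega) hkn] at h1
  omega

/-- Any element of `C^k \ C^(k+1)` spans `C^k` modulo `C^(k+1)`. -/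
lemma exists_smul_add (hfil : IsFiliform L) {k : ℕ} (hk : 2 ≤ k) (hkn : k + 1 ≤ finrank ℂ L)
    {a v : L} (ha : a ∈ C L k) (ha' : a ∉ C L (k + 1)) (hv : v ∈ C L k) :
    ∃ c : ℂ, ∃ w ∈ C L (k + 1), v = w + c • a := by
  have h := sup_span_singleton_eq (N := (C L (k + 1)).toSubmodule) (M := (C L k).toSubmodule)
    (C_antitone (Nat.le_succ k)) ha ha' (by
      have h1 : finrank ℂ (C L k) ≤ finrank ℂ (C L (k + 1)) + 1 := by
        rw [hfil k hk (by omega), hfil (k + 1) (by omega) hkn]; omega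
      exact h1)
  have hv' : v ∈ (C L (k + 1)).toSubmodule ⊔ Submodule.span ℂ {a} := h ▸ hv
  obtain ⟨w, hw, u, hu, rfl⟩ := Submodule.mem_sup.1 hv'
  obtain ⟨c, rfl⟩ := Submodule.mem_span_singleton.1 hu
  exact ⟨c, w, hw, rfl⟩

/-- Two elements independent modulo `C^2` span the algebra modulo `C^2`. -/
lemma sup_span_pair_eq_top (hfil : IsFiliform L) (hn : 2 ≤ finrank ℂ L) {x y : L}
    (hy : y ∉ C L 2) (hx : x ∉ (C L 2).toSubmodule ⊔ Submodule.span ℂ {y}) :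
    (C L 2).toSubmodule ⊔ Submodule.span ℂ {y} ⊔ Submodule.span ℂ {x} = ⊤ := by
  refine sup_span_singleton_eq le_top Submodule.mem_top hx ?_
  have h1 : finrank ℂ (C L 2) = finrank ℂ L - 2 := hfil 2 le_rfl hn
  have h2 : finrank ℂ (C L 2).toSubmodule <
      finrank ℂ ((C L 2).toSubmodule ⊔ Submodule.span ℂ {y} : Submodule ℂ L) := by
    refine Submodule.finrank_lt_finrank_of_lt (lt_of_le_of_ne le_sup_left fun h => hy ?_)
    change y ∈ (C L 2).toSubmodule
    rw [h]
    exact Submodule.mem_sup_right (Submodule.mem_span_singleton_self y)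
  have h3 : finrank ℂ (C L 2).toSubmodule = finrank ℂ L - 2 := h1
  rw [finrank_top]
  omega

lemma exists_notMem_sup_span (hfil : IsFiliform L) (hn : 2 ≤ finrank ℂ L) (y : L) :
    ∃ x : L, x ∉ (C L 2).toSubmodule ⊔ Submodule.span ℂ {y} := by
  by_contra! h
  have h1 : (C L 2).toSubmodule ⊔ Submodule.span ℂ {y} = ⊤ := eq_top_iff.2 fun x _ => h x
  have h2 := Submodule.finrank_add_le_finrank_add_finrank (C L 2).toSubmodule
    (Submodule.span ℂ {y})
  have h3 : finrank ℂ (C L 2).toSubmodule = finrank ℂ L - 2 := hfil 2 le_rfl hn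
  have h4 : finrank ℂ (Submodule.span ℂ {y}) ≤ 1 := by
    simpa using finrank_span_le_card (R := ℂ) ({y} : Set L)
  rw [h1, finrank_top] at h2
  omega

/-- A representative `a` of `C^k / C^(k+1)` (any element outside `C^2` if `k = 1`) is moved
onto a generator of `C^(k+1) / C^(k+2)` by some element. -/
lemma exists_lie_notMem (hfil : IsFiliform L) {k : ℕ} (hk : 1 ≤ k) (hkn : k + 2 ≤ finrank ℂ L)
    {a : L} (ha : a ∈ C L k) (ha' : a ∉ C L (k + 1)) : ∃ x : L, ⁅x, a⁆ ∉ C L (k + 2) := by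
  by_contra! h
  refine hfil.not_C_le_succ (k := k + 1) (by omega) (by omega) (C_succ_le hk fun x v hv => ?_)
  change ⁅x, v⁆ ∈ C L (k + 2)
  rcases hk.eq_or_lt with rfl | hk'
  · obtain ⟨z, hz⟩ := hfil.exists_notMem_sup_span (by omega) a
    have htop := hfil.sup_span_pair_eq_top (by omega) ha' hz
    -- modulo `C^2` every element is a combination of `a` and `z`, so only `[z, a]` matters
    have key : ∀ u : L, ∃ w ∈ C L 2, ∃ c d : ℂ, u = w + c • a + d • z := by
      intro u
      have hu : u ∈ (C L 2).toSubmodule ⊔ Submodule.span ℂ {a} ⊔ Submodule.span ℂ {z} :=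
        htop ▸ Submodule.mem_top
      obtain ⟨s, hs, t, ht, rfl⟩ := Submodule.mem_sup.1 hu
      obtain ⟨w, hw, r, hr, rfl⟩ := Submodule.mem_sup.1 hs
      obtain ⟨c, rfl⟩ := Submodule.mem_span_singleton.1 hr
      obtain ⟨d, rfl⟩ := Submodule.mem_span_singleton.1 ht
      exact ⟨w, hw, c, d, rfl⟩
    obtain ⟨w, hw, c, d, rfl⟩ := key v
    obtain ⟨w', hw', c', d', rfl⟩ := key x
    have hz1 : ⁅w' + c' • a + d' • z, z⁆ ∈ C L 3 := by
      have e : ⁅w' + c' • a + d' • z, z⁆ = ⁅w', z⁆ - c' • ⁅z, a⁆ := by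
        simp only [add_lie, smul_lie, lie_self, smul_zero, add_zero]
        rw [← lie_skew a z, smul_neg, sub_eq_add_neg]
      rw [e]
      exact sub_mem (lie_mem_C' (by omega) z hw') (SMulMemClass.smul_mem c' (h z))
    rw [lie_add, lie_add, lie_smul, lie_smul]
    exact add_mem (add_mem (lie_mem_C (by omega) _ hw) (SMulMemClass.smul_mem c (h _)))
      (SMulMemClass.smul_mem d hz1)
  · obtain ⟨c, w, hw, rfl⟩ := hfil.exists_smul_add (by omega) (by omega) ha ha' hv
    rw [lie_add, lie_smul]
    exact add_mem (lie_mem_C (by omega) _ hw) (SMulMemClass.smul_mem c (h _))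

/-- Since a vector space over an infinite field is not a finite union of proper subspaces, one
element `x` can be chosen with `⁅x, C^k⁆ ⊄ C^(k+2)` for all relevant `k`, and `⁅x, y⁆ ∉ C^3`. -/
lemma exists_generic (hfil : IsFiliform L) (hn : 3 ≤ finrank ℂ L) {y : L} (hy : y ∉ C L 2) :
    ∃ x : L, ⁅x, y⁆ ∉ C L 3 ∧ ∀ k : ℕ, 2 ≤ k → k + 2 ≤ finrank ℂ L →
      ∀ v ∈ C L k, v ∉ C L (k + 1) → ⁅x, v⁆ ∉ C L (k + 2) := by
  classical
  have hrep : ∀ k : ℕ, ∃ a : L, 1 ≤ k → k + 2 ≤ finrank ℂ L →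
      a ∈ C L k ∧ a ∉ C L (k + 1) ∧ (k = 1 → a = y) := by
    intro k
    by_cases h1 : 2 ≤ k ∧ k + 2 ≤ finrank ℂ L
    · obtain ⟨a, ha, ha'⟩ := SetLike.not_le_iff_exists.1 (hfil.not_C_le_succ h1.1 (by omega))
      exact ⟨a, fun _ _ => ⟨ha, ha', by omega⟩⟩
    · refine ⟨y, fun h2 h3 => ?_⟩
      obtain rfl : k = 1 := by omega
      exact ⟨mem_C_one y, hy, fun _ => rfl⟩
  choose a ha using hrep
  let W : ℕ → Submodule ℂ L := fun k => (C L (k + 2)).toSubmodule.comap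
    ((LieAlgebra.ad ℂ L : L →ₗ[ℂ] Module.End ℂ L).flip (a k))
  have hW : ∀ k x, x ∈ W k ↔ ⁅x, a k⁆ ∈ C L (k + 2) := fun k x => Iff.rfl
  have hx : ∃ x : L, ∀ k : ℕ, 1 ≤ k → k + 2 ≤ finrank ℂ L → x ∉ W k := by
    by_contra! hc
    let s := (Finset.range (finrank ℂ L)).filter fun k => 1 ≤ k ∧ k + 2 ≤ finrank ℂ L
    obtain ⟨⟨k, hk⟩, hk'⟩ := Subspace.exists_eq_top_of_iUnion_eq_univ (k := ℂ)
      (p := fun i : s => W i.1) (by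
        refine Set.eq_univ_of_forall fun x => ?_
        obtain ⟨k, h1, h2, h3⟩ := hc x
        refine Set.mem_iUnion.2 ⟨⟨k, ?_⟩, h3⟩
        simp only [s, Finset.mem_filter, Finset.mem_range]
        omega)
    simp only [s, Finset.mem_filter, Finset.mem_range] at hk
    obtain ⟨x, hx⟩ := hfil.exists_lie_notMem hk.2.1 hk.2.2 (ha k hk.2.1 hk.2.2).1
      (ha k hk.2.1 hk.2.2).2.1
    refine hx ((hW k x).1 ?_)
    simp only at hk'
    rw [hk']
    exact Submodule.mem_top
  obtain ⟨x, hx⟩ := hx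
  refine ⟨x, ?_, fun k hk hkn v hv hv' hxv => ?_⟩
  · have := hx 1 le_rfl hn
    rwa [hW, (ha 1 le_rfl hn).2.2 rfl] at this
  · obtain ⟨h1, h2, -⟩ := ha k (by omega) hkn
    refine hx k (by omega) hkn ((hW k x).2 ?_)
    obtain ⟨c, w, hw, e⟩ := hfil.exists_smul_add hk (by omega) hv hv' h1
    rw [e, lie_add, lie_smul]
    exact add_mem (lie_mem_C (by omega) _ hw) (SMulMemClass.smul_mem c hxv)

end IsFiliform

end Filiform

lemma sum_Icc_succ_eq_add_sum {V : Type*} [AddCommMonoid V] {a N : ℕ} (h : a ≤ N + 1) (f : ℕ → V) :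
    ∑ i ∈ Finset.Icc a (N + 1), f i = f a + ∑ i ∈ Finset.Icc a N, f (i + 1) := by
  rw [← Finset.insert_Icc_add_one_left_eq_Icc h, Finset.sum_insert (by simp),
    ← Finset.map_add_right_Icc, Finset.sum_map]
  rfl

/-! ### Coordinates -/

section Coordinates

variable {L : Type*} [LieRing L] [LieAlgebra ℂ L] {n : ℕ} (b : Basis (Set.Icc 1 n) ℂ L)

lemma vec_of_mem {h : ℕ} (hh : h ∈ Set.Icc 1 n) : vec b h = b ⟨h, hh⟩ := dif_pos hh

lemma vec_eq_zero {h : ℕ} (hh : h ∉ Set.Icc 1 n) : vec b h = 0 := dif_neg hh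

lemma P_of_mem {h : ℕ} (hh : h ∈ Set.Icc 1 n) : P b h = b.coord ⟨h, hh⟩ := dif_pos hh

lemma P_eq_zero {h : ℕ} (hh : h ∉ Set.Icc 1 n) : P b h = 0 := dif_neg hh

lemma P_vec {h i : ℕ} (hi : 1 ≤ i) (hin : i ≤ n) : P b h (vec b i) = if h = i then 1 else 0 := by
  rw [vec_of_mem b ⟨hi, hin⟩]
  by_cases hh : h ∈ Set.Icc 1 n
  · rw [P_of_mem b hh]
    simp [Finsupp.single_apply, eq_comm (a := h), Subtype.ext_iff]
  · rw [P_eq_zero b hh, if_neg (by rintro rfl; exact hh ⟨hi, hin⟩)]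
    rfl

lemma ext_P {u v : L} (h : ∀ i, 1 ≤ i → i ≤ n → P b i u = P b i v) : u = v := by
  refine b.ext_elem fun i => ?_
  have := h i.1 i.2.1 i.2.2
  rwa [P_of_mem b i.2] at this

/-- Linear maps are determined by their values on the `vec b i`. -/
lemma linearMap_ext_vec {f g : L →ₗ[ℂ] ℂ}
    (h : ∀ i, 1 ≤ i → i ≤ n → f (vec b i) = g (vec b i)) : f = g := by
  refine b.ext fun i => ?_
  have := h i.1 i.2.1 i.2.2
  rwa [vec_of_mem b i.2] at this

lemma sum_P_smul_vec {v : L} {N : ℕ} (h1 : P b 1 v = 0) (hN : ∀ h, N < h → P b h v = 0) :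
    ∑ h ∈ Finset.Icc 2 N, P b h v • vec b h = v := by
  refine ext_P b fun i hi hin => ?_
  rw [map_sum]
  have e : ∀ h ∈ Finset.Icc 2 N, P b i (P b h v • vec b h) = if i = h then P b i v else 0 := by
    intro h hh
    rw [Finset.mem_Icc] at hh
    rw [map_smul, smul_eq_mul]
    by_cases hhn : h ≤ n
    · rw [P_vec b (by omega) hhn]
      split_ifs with hih
      · rw [hih, mul_one]
      · rw [mul_zero]
    · rw [vec_eq_zero b (fun h' => hhn h'.2), map_zero, mul_zero, if_neg (by omega)]
  rw [Finset.sum_congr rfl e, Finset.sum_ite_eq]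
  split_ifs with hmem
  · rfl
  · rw [Finset.mem_Icc] at hmem
    rcases hi.eq_or_lt with rfl | hi'
    · exact h1.symm
    · exact (hN i (by omega)).symm

end Coordinates

/-! ### The shift by the first basis vector -/

section Shift

variable {L : Type*} [LieRing L] [LieAlgebra ℂ L] {n : ℕ} {b : Basis (Set.Icc 1 n) ℂ L}

/-- `ad e_1` shifts the coordinates down by one. -/
lemma P_lie_vec_one (h12 : ⁅vec b 1, vec b 2⁆ = 0)
    (h1 : ∀ h : ℕ, 3 ≤ h → h ≤ n → ⁅vec b 1, vec b h⁆ = vec b (h - 1))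
    {h : ℕ} (hh : 2 ≤ h) (v : L) : P b h ⁅vec b 1, v⁆ = P b (h + 1) v := by
  have e : (P b h).comp (LieAlgebra.ad ℂ L (vec b 1)) = P b (h + 1) := by
    refine linearMap_ext_vec b fun i hi hin => ?_
    rw [LinearMap.comp_apply, LieAlgebra.ad_apply, P_vec b hi hin]
    obtain rfl | rfl | hi3 : i = 1 ∨ i = 2 ∨ 3 ≤ i := by omega
    · rw [lie_self, map_zero, if_neg (by omega)]
    · rw [h12, map_zero, if_neg (by omega)]
    · rw [h1 i hi3 hin, P_vec b (by omega) (by omega)]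
      exact if_congr (by omega) rfl rfl
  exact LinearMap.congr_fun e v

/-- A sequence in the span of `e_2, …, e_n` that starts in the kernel of `ad e_1` and in which
`ad e_1` maps each term to the previous one has "Toeplitz" coordinates. -/
lemma eq_sum_of_lie_succ_eq (h12 : ⁅vec b 1, vec b 2⁆ = 0)
    (h1 : ∀ h : ℕ, 3 ≤ h → h ≤ n → ⁅vec b 1, vec b h⁆ = vec b (h - 1))
    {u : ℕ → L} {N : ℕ} (hu : ∀ i ≤ N, P b 1 (u i) = 0)
    (hu0 : ⁅vec b 1, u 0⁆ = 0) (hu1 : ∀ i < N, ⁅vec b 1, u (i + 1)⁆ = u i) :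
    ∀ i ≤ N, u i = ∑ m ∈ Finset.Icc 1 (i + 1), P b 2 (u (m - 1)) • vec b (i + 3 - m) := by
  -- the coordinate of `u i` at `e_(h+2)` is that of `u (i-h)` at `e_2`, and zero if `h > i`
  have key : ∀ h i, i ≤ N → P b (h + 2) (u i) = if h ≤ i then P b 2 (u (i - h)) else 0 := by
    intro h
    induction h with
    | zero => intro i _; simp
    | succ h ih =>
      intro i hi
      rw [show h + 1 + 2 = h + 2 + 1 by omega, ← P_lie_vec_one h12 h1 (by omega)]
      cases i with
      | zero => rw [hu0, map_zero, if_neg (by omega)]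
      | succ i =>
        rw [hu1 i (by omega), ih i (by omega), Nat.add_sub_add_right]
        exact if_congr (by omega) rfl rfl
  intro i hi
  rw [← sum_P_smul_vec b (N := i + 2) (hu i hi) (fun h hh => by
    obtain ⟨j, rfl⟩ := Nat.exists_eq_add_of_le' (show 2 ≤ h by omega)
    rw [key j i hi, if_neg (by omega)])]
  refine Finset.sum_bij' (fun h _ => i + 3 - h) (fun m _ => i + 3 - m) ?_ ?_ ?_ ?_ ?_
  · intro h hh; rw [Finset.mem_Icc] at hh ⊢; omega
  · intro h hh; rw [Finset.mem_Icc] at hh ⊢; omega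
  · intro h hh; rw [Finset.mem_Icc] at hh; omega
  · intro h hh; rw [Finset.mem_Icc] at hh; omega
  · intro h hh
    rw [Finset.mem_Icc] at hh
    obtain ⟨j, rfl⟩ := Nat.exists_eq_add_of_le' hh.1
    rw [key j i hi, if_pos (by omega), show i + 3 - (i + 3 - (j + 2)) = j + 2 by omega,
      show i + 3 - (j + 2) - 1 = i - j by omega]

end Shift

/-! ### Bases compatible with the lower central series -/

section Basis

variable {L : Type*} [LieRing L] [LieAlgebra ℂ L] [FiniteDimensional ℂ L]

/-- A filiform Lie algebra has, for any prescribed `e_n ∉ C^2`, a basis `e_1, …, e_n` in which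
`ad e_1` is a shift and which is compatible with the lower central series. -/
lemma IsFiliform.exists_basis (hfil : IsFiliform L) (hn : 3 ≤ finrank ℂ L) {y : L}
    (hy : y ∉ C L 2) :
    ∃ b : Basis (Set.Icc 1 (finrank ℂ L)) ℂ L, vec b (finrank ℂ L) = y ∧
      (∀ h : ℕ, 3 ≤ h → h ≤ finrank ℂ L → ⁅vec b 1, vec b h⁆ = vec b (h - 1)) ∧
      (∀ h : ℕ, 2 ≤ h → h ≤ finrank ℂ L → vec b h ∈ C L (finrank ℂ L + 1 - h)) ∧
      ∀ v ∈ C L 2, P b 1 v = 0 := by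
  obtain ⟨x, hxy, hx⟩ := hfil.exists_generic hn hy
  set n := finrank ℂ L with hndef
  let f : L → L := fun v => ⁅x, v⁆
  -- `e_h` is the iterate `(ad x)^(n-h) y`, and it generates `C^(n+1-h)` modulo the next ideal
  have hf : ∀ j, j + 2 ≤ n → f^[j] y ∈ C L (j + 1) ∧ f^[j] y ∉ C L (j + 2) := by
    intro j
    induction j with
    | zero => exact fun _ => ⟨mem_C_one y, hy⟩
    | succ j ih =>
      intro hj
      obtain ⟨h1, h2⟩ := ih (by omega)
      rw [Function.iterate_succ_apply']
      refine ⟨lie_mem_C (by omega) x h1, ?_⟩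
      cases j with
      | zero => exact hxy
      | succ j => exact hx (j + 1 + 1) (by omega) (by omega) _ h1 h2
  let g : Set.Icc 1 n → L := fun h => if h.1 = 1 then x else f^[n - h.1] y
  have hg : ∀ (h : ℕ) (h2 : 2 ≤ h) (hn' : h ≤ n), g ⟨h, by omega, hn'⟩ = f^[n - h] y :=
    fun h h2 hn' => if_neg (by simp only; omega)
  let S : Submodule ℂ L := Submodule.span ℂ (g '' {h | h.1 ≠ 1})
  -- induction up the lower central series, from `C^n = 0` to `C^2`
  have hS : ∀ d, d + 2 ≤ n → (C L (n - d)).toSubmodule ≤ S := by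
    intro d
    induction d with
    | zero =>
      intro _
      rw [Nat.sub_zero, hfil.C_eq_bot (by omega)]
      simp
    | succ d ih =>
      intro hd v hv
      obtain ⟨k, hk⟩ : ∃ k, k = n - (d + 1) := ⟨_, rfl⟩
      rw [← hk] at hv
      have hfk := hf (k - 1) (by omega)
      rw [show k - 1 + 1 = k by omega, show k - 1 + 2 = k + 1 by omega] at hfk
      obtain ⟨c, w, hw, rfl⟩ := hfil.exists_smul_add (by omega) (by omega) hfk.1 hfk.2 hv
      rw [show k + 1 = n - d by omega] at hw
      refine S.add_mem (ih (by omega) hw) (S.smul_mem c (Submodule.subset_span ?_))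
      refine ⟨⟨d + 2, by omega, by omega⟩, by simp, ?_⟩
      rw [hg _ (by omega) (by omega), show n - (d + 2) = k - 1 by omega]
  have hC2 : (C L 2).toSubmodule ≤ S := by
    have := hS (n - 2) (by omega)
    rwa [show n - (n - 2) = 2 by omega] at this
  have hSr : S ≤ Submodule.span ℂ (Set.range g) := Submodule.span_mono (Set.image_subset_range _ _)
  have hxn : x ∉ (C L 2).toSubmodule ⊔ Submodule.span ℂ {y} := by
    intro hmem
    obtain ⟨w, hw, u, hu, e⟩ := Submodule.mem_sup.1 hmem
    obtain ⟨c, rfl⟩ := Submodule.mem_span_singleton.1 hu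
    refine hxy ?_
    rw [← e, add_lie, smul_lie, lie_self, smul_zero, add_zero]
    exact lie_mem_C' (by omega) y hw
  have htop : ⊤ ≤ Submodule.span ℂ (Set.range g) := by
    rw [← hfil.sup_span_pair_eq_top (by omega) hy hxn]
    refine sup_le (sup_le (hC2.trans hSr) ?_) ?_
    · refine (Submodule.span_singleton_le_iff_mem _ _).2 (Submodule.subset_span ?_)
      refine ⟨⟨n, by omega, le_rfl⟩, ?_⟩
      rw [hg _ (by omega) le_rfl, Nat.sub_self]
      rfl
    · exact (Submodule.span_singleton_le_iff_mem _ _).2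
        (Submodule.subset_span ⟨⟨1, le_rfl, by omega⟩, if_pos rfl⟩)
  let b := basisOfTopLeSpanOfCardEqFinrank g htop (by simp [hndef])
  have hb : ∀ (h : ℕ) (hh : h ∈ Set.Icc 1 n), vec b h = g ⟨h, hh⟩ := by
    intro h hh
    rw [vec_of_mem b hh, coe_basisOfTopLeSpanOfCardEqFinrank]
  have hb1 : vec b 1 = x := by rw [hb 1 ⟨le_rfl, by omega⟩]; exact if_pos rfl
  have hb2 : ∀ h, 2 ≤ h → h ≤ n → vec b h = f^[n - h] y := fun h h2 hn' => by
    rw [hb h ⟨by omega, hn'⟩, hg _ h2 hn']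
  refine ⟨b, ?_, fun h h3 hn' => ?_, fun h h2 hn' => ?_, fun v hv => ?_⟩
  · rw [hb2 n (by omega) le_rfl, Nat.sub_self]; rfl
  · rw [hb1, hb2 h (by omega) hn', hb2 (h - 1) (by omega) (by omega),
      show n - (h - 1) = n - h + 1 by omega, Function.iterate_succ_apply']
  · rw [hb2 h h2 hn', show n + 1 - h = n - h + 1 by omega]
    exact (hf _ (by omega)).1
  · have hle : S ≤ LinearMap.ker (P b 1) := by
      refine Submodule.span_le.2 ?_
      rintro _ ⟨⟨h, hh⟩, hh1, rfl⟩
      change P b 1 (g ⟨h, hh⟩) = 0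
      rw [← hb h hh, P_vec b hh.1 hh.2, if_neg (fun e => hh1 e.symm)]
    exact hle (hC2 hv)

end Basis

/-! ### The invariants and the basis they determine -/

lemma lie_eq_zero_symm {L : Type*} [LieRing L] {u v : L} (h : ⁅u, v⁆ = 0) : ⁅v, u⁆ = 0 := by
  rw [← lie_skew, h, neg_zero]

section Invariants

variable {L : Type*} [LieRing L] [LieAlgebra ℂ L]

lemma z₁_mem {k : ℕ} (hk : k ≤ finrank ℂ L + 1)
    (h : (C L 2 : Set L) ⊂ centralizer (C L (finrank ℂ L + 2 - k))) :
    (C L 2 : Set L) ⊂ centralizer (C L (finrank ℂ L + 2 - z₁ L)) :=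
  (Nat.sSup_mem (s := {k : ℕ | k ≤ finrank ℂ L + 1 ∧
    (C L 2 : Set L) ⊂ centralizer (C L (finrank ℂ L + 2 - k))})
    ⟨k, hk, h⟩ ⟨finrank ℂ L + 1, fun _ hk => hk.1⟩).2

lemma le_z₁ {k : ℕ} (hk : k ≤ finrank ℂ L + 1)
    (h : (C L 2 : Set L) ⊂ centralizer (C L (finrank ℂ L + 2 - k))) : k ≤ z₁ L :=
  le_csSup ⟨finrank ℂ L + 1, fun _ hk => hk.1⟩ ⟨hk, h⟩

lemma z₂_mem {k : ℕ} (hk : k ≤ finrank ℂ L)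
    (h : IsLieAbelian (C L (finrank ℂ L + 1 - k))) :
    z₂ L ≤ finrank ℂ L ∧ IsLieAbelian (C L (finrank ℂ L + 1 - z₂ L)) :=
  Nat.sSup_mem (s := {k : ℕ | k ≤ finrank ℂ L ∧
    IsLieAbelian (C L (finrank ℂ L + 1 - k))}) ⟨k, hk, h⟩ ⟨finrank ℂ L, fun _ hk => hk.1⟩

lemma le_z₂ {k : ℕ} (hk : k ≤ finrank ℂ L)
    (h : IsLieAbelian (C L (finrank ℂ L + 1 - k))) : k ≤ z₂ L :=
  le_csSup ⟨finrank ℂ L, fun _ hk => hk.1⟩ ⟨hk, h⟩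

lemma isLieAbelian_of_forall {H : LieIdeal ℂ L} (h : ∀ u ∈ H, ∀ v ∈ H, ⁅u, v⁆ = 0) :
    IsLieAbelian H :=
  ⟨fun u v => Subtype.ext (h u u.2 v v.2)⟩

lemma lie_eq_zero_of_isLieAbelian {H : LieIdeal ℂ L} (h : IsLieAbelian H) {u v : L}
    (hu : u ∈ H) (hv : v ∈ H) : ⁅u, v⁆ = 0 :=
  congrArg Subtype.val (h.trivial ⟨u, hu⟩ ⟨v, hv⟩)

end Invariants

section Filiform

variable {L : Type*} [LieRing L] [LieAlgebra ℂ L] [FiniteDimensional ℂ L]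

namespace IsFiliform

lemma lie_C_pred (hfil : IsFiliform L) (hn : 3 ≤ finrank ℂ L) {v : L}
    (hv : v ∈ C L (finrank ℂ L - 1)) (x : L) : ⁅x, v⁆ = 0 := by
  have h := lie_mem_C (by omega) x hv
  rwa [Nat.sub_add_cancel (by omega), hfil.C_eq_bot (by omega), LieSubmodule.mem_bot] at h

/-- The index `3` is admissible in the definition of `z₁`, because `C^(n-1)` is central. -/
lemma ssubset_centralizer_three (hfil : IsFiliform L) (hn : 3 ≤ finrank ℂ L) :
    (C L 2 : Set L) ⊂ centralizer (C L (finrank ℂ L + 2 - 3)) := by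
  rw [show finrank ℂ L + 2 - 3 = finrank ℂ L - 1 by omega]
  have hall : ∀ x : L, x ∈ centralizer (C L (finrank ℂ L - 1)) :=
    fun x v hv => hfil.lie_C_pred hn hv x
  obtain ⟨x, hx⟩ := hfil.exists_notMem_sup_span (by omega) (0 : L)
  exact (Set.ssubset_iff_of_subset fun u _ => hall u).2
    ⟨x, hall x, fun h => hx (Submodule.mem_sup_left h)⟩

lemma three_le_z₁ (hfil : IsFiliform L) (hn : 3 ≤ finrank ℂ L) : 3 ≤ z₁ L :=
  le_z₁ (by omega) (hfil.ssubset_centralizer_three hn)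

/-- The centralizer of `C^(n-2)` is the kernel of `ad a` for any `a ∈ C^(n-2) \ C^(n-1)`; as `ad a`
takes values in the line `C^(n-1)`, that kernel has codimension at most one, unlike `C^2`. -/
lemma four_le_z₁ (hfil : IsFiliform L) (hn : 4 ≤ finrank ℂ L) : 4 ≤ z₁ L := by
  refine le_z₁ (by omega) ?_
  rw [show finrank ℂ L + 2 - 4 = finrank ℂ L - 2 by omega]
  obtain ⟨a, ha, ha'⟩ := SetLike.not_le_iff_exists.1
    (hfil.not_C_le_succ (k := finrank ℂ L - 2) (by omega) (by omega))
  have hda : ∀ x : L, ⁅x, a⁆ ∈ C L (finrank ℂ L - 1) := fun x => by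
    have := lie_mem_C (by omega) x ha
    rwa [show finrank ℂ L - 2 + 1 = finrank ℂ L - 1 by omega] at this
  have hker : ∀ x : L, ⁅x, a⁆ = 0 → x ∈ centralizer (C L (finrank ℂ L - 2)) := by
    intro x hx v hv
    obtain ⟨c, w, hw, rfl⟩ := hfil.exists_smul_add (by omega) (by omega) ha ha' hv
    rw [show finrank ℂ L - 2 + 1 = finrank ℂ L - 1 by omega] at hw
    rw [lie_add, lie_smul, hx, smul_zero, add_zero, hfil.lie_C_pred (by omega) hw]
  let f : L →ₗ[ℂ] L := (LieAlgebra.ad ℂ L : L →ₗ[ℂ] Module.End ℂ L).flip a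
  have hf : ∀ x, f x = ⁅x, a⁆ := fun x => rfl
  have hC2 : (C L 2).toSubmodule ≤ LinearMap.ker f := by
    refine C_succ_le le_rfl fun x v _ => ?_
    rw [LinearMap.mem_ker, hf, lie_lie, hfil.lie_C_pred (by omega) (hda v),
      hfil.lie_C_pred (by omega) (hda x), sub_zero]
  have hrange : finrank ℂ (LinearMap.range f) ≤ 1 := by
    have h1 : LinearMap.range f ≤ (C L (finrank ℂ L - 1)).toSubmodule := by
      rintro _ ⟨x, rfl⟩
      exact hda x
    have h2 : finrank ℂ (C L (finrank ℂ L - 1)).toSubmodule = finrank ℂ L - (finrank ℂ L - 1) :=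
      hfil (finrank ℂ L - 1) (by omega) (by omega)
    have h3 := Submodule.finrank_mono h1
    omega
  have hnot : ¬ LinearMap.ker f ≤ (C L 2).toSubmodule := by
    intro h
    have h1 := Submodule.finrank_mono h
    have h2 : finrank ℂ (C L 2).toSubmodule = finrank ℂ L - 2 := hfil 2 le_rfl (by omega)
    have h3 := f.finrank_range_add_finrank_ker
    omega
  obtain ⟨x, hx, hx'⟩ := SetLike.not_le_iff_exists.1 hnot
  exact (Set.ssubset_iff_of_subset fun u hu => hker u (hC2 hu)).2 ⟨x, hker x hx, hx'⟩

lemma ssubset_centralizer_z₁ (hfil : IsFiliform L) (hn : 3 ≤ finrank ℂ L) :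
    (C L 2 : Set L) ⊂ centralizer (C L (finrank ℂ L + 2 - z₁ L)) :=
  z₁_mem (by omega) (hfil.ssubset_centralizer_three hn)

lemma isLieAbelian_z₂ (hfil : IsFiliform L) (hn : 3 ≤ finrank ℂ L) :
    z₂ L ≤ finrank ℂ L ∧ IsLieAbelian (C L (finrank ℂ L + 1 - z₂ L)) := by
  refine z₂_mem (k := 1) (by omega) ?_
  rw [Nat.add_sub_cancel, hfil.C_eq_bot (by omega)]
  infer_instance

/-- Otherwise the whole algebra would be abelian, although `C^2` has dimension `n - 2 > 0`. -/
lemma z₂_lt (hfil : IsFiliform L) (hn : 3 ≤ finrank ℂ L) : z₂ L < finrank ℂ L := by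
  obtain ⟨h, hab⟩ := hfil.isLieAbelian_z₂ hn
  refine lt_of_le_of_ne h fun e => ?_
  rw [e, Nat.add_sub_cancel_left] at hab
  refine hfil.not_C_le_succ le_rfl hn (C_succ_le le_rfl fun x v _ => ?_)
  rw [lie_eq_zero_of_isLieAbelian hab (mem_C_one x) (mem_C_one v)]
  exact zero_mem _

/-- `C^(n-z₁+1)` is spanned by one element modulo `C^(n-z₁+2)`, which it centralizes as it is
contained in `C^2`; hence it is abelian. -/
lemma z₁_le_z₂ (hfil : IsFiliform L) (hn : 3 ≤ finrank ℂ L) (hz : z₁ L < finrank ℂ L) :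
    z₁ L ≤ z₂ L := by
  have h3 := hfil.three_le_z₁ hn
  have hc := (hfil.ssubset_centralizer_z₁ hn).subset
  obtain ⟨a, ha, ha'⟩ := SetLike.not_le_iff_exists.1
    (hfil.not_C_le_succ (k := finrank ℂ L + 1 - z₁ L) (by omega) (by omega))
  have hzero : ∀ u ∈ C L (finrank ℂ L + 1 - z₁ L), ∀ v ∈ C L (finrank ℂ L + 1 - z₁ L + 1),
      ⁅u, v⁆ = 0 := by
    intro u hu v hv
    rw [show finrank ℂ L + 1 - z₁ L + 1 = finrank ℂ L + 2 - z₁ L by omega] at hv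
    exact hc (C_antitone (show 2 ≤ finrank ℂ L + 1 - z₁ L by omega) hu) v hv
  refine le_z₂ hz.le (isLieAbelian_of_forall fun u hu v hv => ?_)
  obtain ⟨c, w, hw, rfl⟩ := hfil.exists_smul_add (by omega) (by omega) ha ha' hv
  rw [lie_add, hzero u hu w hw, zero_add, lie_smul]
  obtain ⟨d, w', hw', rfl⟩ := hfil.exists_smul_add (by omega) (by omega) ha ha' hu
  rw [add_lie, lie_eq_zero_symm (hzero a ha w' hw'), smul_lie, lie_self, smul_zero, add_zero,
    smul_zero]

/-- The basis that puts the algebra into the normal form: `e_n` is chosen in the centralizer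
that defines `z₁`. -/
lemma exists_basis_lie_eq_zero (hfil : IsFiliform L) (hn : 3 ≤ finrank ℂ L) :
    ∃ b : Basis (Set.Icc 1 (finrank ℂ L)) ℂ L,
      (∀ h : ℕ, 3 ≤ h → h ≤ finrank ℂ L → ⁅vec b 1, vec b h⁆ = vec b (h - 1)) ∧
      ⁅vec b 1, vec b 2⁆ = 0 ∧ (∀ u v : L, P b 1 ⁅u, v⁆ = 0) ∧
      (∀ i j : ℕ, 2 ≤ i → i ≤ finrank ℂ L → i < z₁ L → 2 ≤ j → j ≤ finrank ℂ L →
        ⁅vec b i, vec b j⁆ = 0) ∧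
      ∀ i j : ℕ, 2 ≤ i → i ≤ z₂ L → 2 ≤ j → j ≤ z₂ L → ⁅vec b i, vec b j⁆ = 0 := by
  obtain ⟨hsub, y, hyc, hy⟩ := (Set.ssubset_iff_exists).1 (hfil.ssubset_centralizer_z₁ hn)
  obtain ⟨b, hbn, hb1, hbC, hbP⟩ := hfil.exists_basis hn hy
  obtain ⟨hz2, hab⟩ := hfil.isLieAbelian_z₂ hn
  refine ⟨b, hb1, ?_, fun u v => hbP _ (lie_mem_C le_rfl u (mem_C_one v)),
    fun i j hi hin hiz hj hjn => lie_eq_zero_symm ?_, fun i j hi hiz hj hjz => ?_⟩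
  · refine hfil.lie_C_pred hn ?_ _
    have := hbC 2 le_rfl (by omega)
    rwa [show finrank ℂ L + 1 - 2 = finrank ℂ L - 1 by omega] at this
  · have hjc : vec b j ∈ centralizer (C L (finrank ℂ L + 2 - z₁ L)) := by
      rcases hjn.eq_or_lt with rfl | hjn'
      · rwa [hbn]
      · exact hsub (C_antitone (show 2 ≤ finrank ℂ L + 1 - j by omega) (hbC j hj hjn))
    exact hjc _ (C_antitone (show finrank ℂ L + 2 - z₁ L ≤ finrank ℂ L + 1 - i by omega)
      (hbC i hi hin))
  · exact lie_eq_zero_of_isLieAbelian hab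
      (C_antitone (show finrank ℂ L + 1 - z₂ L ≤ finrank ℂ L + 1 - i by omega)
        (hbC i hi (by omega)))
      (C_antitone (show finrank ℂ L + 1 - z₂ L ≤ finrank ℂ L + 1 - j by omega)
        (hbC j hj (by omega)))

/-- In dimension at most two a filiform Lie algebra is abelian. -/
lemma isModel_of_finrank_lt_three (hfil : IsFiliform L) (hn : finrank ℂ L < 3) : IsModel L := by
  have hzero : ∀ u v : L, ⁅u, v⁆ = 0 := by
    intro u v
    rcases Nat.lt_or_ge (finrank ℂ L) 2 with h | h
    · obtain ⟨w, hw⟩ := finrank_le_one_iff.1 (Nat.lt_succ_iff.1 h)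
      obtain ⟨c, rfl⟩ := hw u
      obtain ⟨d, rfl⟩ := hw v
      rw [smul_lie, lie_smul, lie_self, smul_zero, smul_zero]
    · have h1 := hfil.C_eq_bot h
      rw [show finrank ℂ L = 2 by omega] at h1
      have h2 := lie_mem_C le_rfl u (mem_C_one v)
      rwa [h1, LieSubmodule.mem_bot] at h2
  refine ⟨(finBasis ℂ L).reindex (Fintype.equivOfCardEq (by simp)),
    ⟨fun h h3 h' => by omega, fun _ _ _ => hzero _ _, fun _ _ _ => hzero _ _⟩,
    fun _ _ _ _ _ _ => hzero _ _⟩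

/-- If `z₁ ≥ n` then `e_n` centralizes `C^2`, and so do the other `e_i` with `i ≥ 2`; the algebra is
then model. -/
lemma z₁_lt_of_not_isModel (hfil : IsFiliform L) (hn : 3 ≤ finrank ℂ L) (hmod : ¬ IsModel L) :
    z₁ L < finrank ℂ L := by
  by_contra! hz
  obtain ⟨b, hb1, hb12, -, hbz, -⟩ := hfil.exists_basis_lie_eq_zero hn
  have hzero : ∀ i j : ℕ, 2 ≤ i → i ≤ finrank ℂ L → 2 ≤ j → j ≤ finrank ℂ L →
      ⁅vec b i, vec b j⁆ = 0 := by
    intro i j hi hin hj hjn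
    rcases hin.eq_or_lt with rfl | hi'
    · rcases hjn.eq_or_lt with rfl | hj'
      · exact lie_self _
      · exact lie_eq_zero_symm (hbz j _ hj hjn (by omega) hi hin)
    · exact hbz i j hi hin (by omega) hj hjn
  refine hmod ⟨b, ⟨hb1, fun h h1 hhn => ?_, fun h h2 hhn => hzero _ _ (by omega) hn h2 hhn⟩, hzero⟩
  rcases h1.eq_or_lt with rfl | h2
  · exact lie_eq_zero_symm hb12
  · exact hzero _ _ le_rfl (by omega) h2 hhn

end IsFiliform

end Filiform

/-! ### Brackets in the normal form -/

section NormalForm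

variable {L : Type*} [LieRing L] [LieAlgebra ℂ L] {n : ℕ} {b : Basis (Set.Icc 1 n) ℂ L}

lemma lie_vec_one_lie (h1 : ∀ h : ℕ, 3 ≤ h → h ≤ n → ⁅vec b 1, vec b h⁆ = vec b (h - 1))
    {i j : ℕ} (hi : 3 ≤ i) (hin : i ≤ n) (hj : 3 ≤ j) (hjn : j ≤ n) :
    ⁅vec b 1, ⁅vec b i, vec b j⁆⁆ = ⁅vec b (i - 1), vec b j⁆ + ⁅vec b i, vec b (j - 1)⁆ := by
  rw [leibniz_lie, h1 i hi hin, h1 j hj hjn]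

/-- The bracket of `e_(p+k)` and `e_(q+l)` lies in the span of the `e_h` with `h ≤ k + l + 1`,
provided the brackets vanish for first index below `p` and for both indices at most `q`. -/
lemma P_lie_eq_zero {p q : ℕ} (hp : 3 ≤ p) (hpq : p ≤ q)
    (h12 : ⁅vec b 1, vec b 2⁆ = 0)
    (h1 : ∀ h : ℕ, 3 ≤ h → h ≤ n → ⁅vec b 1, vec b h⁆ = vec b (h - 1))
    (hbp : ∀ i j : ℕ, 2 ≤ i → i ≤ n → i < p → 2 ≤ j → j ≤ n → ⁅vec b i, vec b j⁆ = 0)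
    (hbq : ∀ i j : ℕ, 2 ≤ i → i ≤ q → 2 ≤ j → j ≤ q → ⁅vec b i, vec b j⁆ = 0) (s : ℕ) :
    ∀ k l : ℕ, k + l = s → q + l ≤ n → p + k ≤ q + l → ∀ h, k + l + 1 < h →
      P b h ⁅vec b (p + k), vec b (q + l)⁆ = 0 := by
  induction s with
  | zero =>
    intro k l hs hln hkl h hh
    rw [hbq _ _ (by omega) (by omega) (by omega) (by omega), map_zero]
  | succ s ih =>
    intro k l hs hln hkl h hh
    rcases Nat.eq_zero_or_pos l with rfl | hl
    · rw [hbq _ _ (by omega) (by omega) (by omega) (by omega), map_zero]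
    rcases hkl.eq_or_lt with e | hkl'
    · rw [e, lie_self, map_zero]
    obtain ⟨h, rfl⟩ := Nat.exists_eq_add_of_le' (show 1 ≤ h by omega)
    rw [← P_lie_vec_one h12 h1 (by omega),
      lie_vec_one_lie h1 (by omega) (by omega) (by omega) hln, map_add]
    have e1 : P b h ⁅vec b (p + k - 1), vec b (q + l)⁆ = 0 := by
      rcases Nat.eq_zero_or_pos k with rfl | hk
      · rw [hbp _ _ (by omega) (by omega) (by omega) (by omega) hln, map_zero]
      · rw [show p + k - 1 = p + (k - 1) by omega]
        exact ih (k - 1) l (by omega) hln (by omega) h (by omega)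
    have e2 : P b h ⁅vec b (p + k), vec b (q + l - 1)⁆ = 0 := by
      rw [show q + l - 1 = q + (l - 1) by omega]
      exact ih k (l - 1) (by omega) (by omega) (by omega) h (by omega)
    rw [e1, e2, add_zero]

end NormalForm

end FiliformLie

theorem mainTheorem2 {L : Type*} [LieRing L] [LieAlgebra ℂ L] [FiniteDimensional ℂ L]
    (n z₁ z₂ : ℕ) (hn : Module.finrank ℂ L = n)
    (hfil : FiliformLie.IsFiliform L) (hmod : ¬ FiliformLie.IsModel L)
    (hz₁ : FiliformLie.z₁ L = z₁) (hz₂ : FiliformLie.z₂ L = z₂) :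
    ∃ b : Module.Basis (Set.Icc 1 n) ℂ L, FiliformLie.IsAdapted b ∧
      ∃ (α γ : ℕ → ℂ) (β : ℕ → ℕ → ℂ),
        (∀ h : ℕ, 3 ≤ h → h ≤ n →
          ⁅FiliformLie.vec b 1, FiliformLie.vec b h⁆ = FiliformLie.vec b (h - 1)) ∧
        (∀ i : ℕ, z₁ + i ≤ z₂ →
          ⁅FiliformLie.vec b (z₁ + i), FiliformLie.vec b (z₂ + 1)⁆ =
            ∑ m ∈ Finset.Icc 1 (i + 1), α m • FiliformLie.vec b (i + 3 - m)) ∧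
        (∀ j : ℕ, 2 ≤ j → z₂ + j ≤ n →
          ⁅FiliformLie.vec b z₁, FiliformLie.vec b (z₂ + j)⁆ =
            α 1 • FiliformLie.vec b (j + 1)
              + ∑ m ∈ Finset.Icc 1 (j - 1), γ m • FiliformLie.vec b (j + 1 - m)) ∧
        (∀ k l : ℕ, 2 ≤ l → z₂ + l ≤ n → 1 ≤ k → z₁ + k < z₂ + l →
          ⁅FiliformLie.vec b (z₁ + k), FiliformLie.vec b (z₂ + l)⁆ =
            (∑ h ∈ Finset.Icc 2 (k + l),
              FiliformLie.P b h
                (⁅FiliformLie.vec b (z₁ + k - 1), FiliformLie.vec b (z₂ + l)⁆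
                  + ⁅FiliformLie.vec b (z₁ + k), FiliformLie.vec b (z₂ + l - 1)⁆)
                • FiliformLie.vec b (h + 1))
              + β k l • FiliformLie.vec b 2) ∧
        -- every bracket not listed above (and not listed up to antisymmetry) vanishes
        ⁅FiliformLie.vec b 1, FiliformLie.vec b 2⁆ = 0 ∧
        (∀ i j : ℕ, 2 ≤ i → i < j → j ≤ n → i < z₁ ∨ j ≤ z₂ →
          ⁅FiliformLie.vec b i, FiliformLie.vec b j⁆ = 0) := by
  subst hn
  have hn3 : 3 ≤ finrank ℂ L := by
    by_contra! h
    exact hmod (hfil.isModel_of_finrank_lt_three h)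
  have hz1n := hfil.z₁_lt_of_not_isModel hn3 hmod
  have hz12 := hfil.z₁_le_z₂ hn3 hz1n
  have hz2n := hfil.z₂_lt hn3
  have hz4 := hfil.four_le_z₁ (by have := hfil.three_le_z₁ hn3; omega)
  obtain ⟨b, h1, h12, hP1, hbp, hbq⟩ := hfil.exists_basis_lie_eq_zero hn3
  rw [hz₁] at hz1n hz12 hz4 hbp
  rw [hz₂] at hz12 hz2n hbq
  -- `ad e_1` lowers the first index when the second is `z₂ + 1`, and the second index when the
  -- first is `z₁`, the other term of the Jacobi identity being zero
  have hα := FiliformLie.eq_sum_of_lie_succ_eq h12 h1 (N := z₂ - z₁)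
    (u := fun i => ⁅FiliformLie.vec b (z₁ + i), FiliformLie.vec b (z₂ + 1)⁆)
    (fun i _ => hP1 _ _)
    (by
      rw [FiliformLie.lie_vec_one_lie h1 (by omega) (by omega) (by omega) (by omega),
        hbp _ _ (by omega) (by omega) (by omega) (by omega) (by omega),
        hbq _ _ (by omega) (by omega) (by omega) (by omega), add_zero])
    (fun i hi => by
      rw [FiliformLie.lie_vec_one_lie h1 (by omega) (by omega) (by omega) (by omega),
        hbq (z₁ + (i + 1)) _ (by omega) (by omega) (by omega) (by omega), add_zero]
      rfl)
  have hγ := FiliformLie.eq_sum_of_lie_succ_eq h12 h1 (N := finrank ℂ L - z₂ - 1)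
    (u := fun j => ⁅FiliformLie.vec b z₁, FiliformLie.vec b (z₂ + 1 + j)⁆)
    (fun i _ => hP1 _ _)
    (by
      rw [FiliformLie.lie_vec_one_lie h1 (by omega) (by omega) (by omega) (by omega),
        hbp _ _ (by omega) (by omega) (by omega) (by omega) (by omega),
        hbq _ _ (by omega) (by omega) (by omega) (by omega), add_zero])
    (fun i hi => by
      rw [FiliformLie.lie_vec_one_lie h1 (by omega) (by omega) (by omega) (by omega),
        hbp (z₁ - 1) _ (by omega) (by omega) (by omega) (by omega) (by omega), zero_add]
      rfl)
  refine ⟨b, ⟨h1, fun h hh hhn => ?_, fun h hh hhn =>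
      hbp _ _ (by omega) (by omega) (by omega) hh hhn⟩,
    fun m => FiliformLie.P b 2 ⁅FiliformLie.vec b (z₁ + (m - 1)), FiliformLie.vec b (z₂ + 1)⁆,
    fun m => FiliformLie.P b 2 ⁅FiliformLie.vec b z₁, FiliformLie.vec b (z₂ + 1 + m)⁆,
    fun k l => FiliformLie.P b 2 ⁅FiliformLie.vec b (z₁ + k), FiliformLie.vec b (z₂ + l)⁆,
    h1, fun i hi => hα i (by omega), fun j hj hjn => ?_, fun k l hl hln hk hkl => ?_, h12,
    fun i j hi hij hjn hor => ?_⟩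
  · rcases hh.eq_or_lt with rfl | h2
    · exact FiliformLie.lie_eq_zero_symm h12
    · exact hbp _ _ le_rfl (by omega) (by omega) h2 hhn
  · obtain ⟨j, rfl⟩ := Nat.exists_eq_add_of_le' (show 1 ≤ j by omega)
    have h := hγ j (by omega)
    rw [show z₂ + (j + 1) = z₂ + 1 + j by omega]
    refine h.trans ?_
    -- the term `m = 1` is the one with coefficient `α 1`; the others are reindexed by `m - 1`
    rw [FiliformLie.sum_Icc_succ_eq_add_sum (by omega)]
    refine congrArg₂ (· + ·) rfl (Finset.sum_congr rfl fun m _ => ?_)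
    rw [show j + 3 - (m + 1) = j + 1 + 1 - m by omega]
    rfl
  · -- the vector whose coordinates occur in the sum is `ad e_1` of the bracket
    rw [← FiliformLie.lie_vec_one_lie h1 (by omega) (by omega) (by omega) hln]
    refine (FiliformLie.sum_P_smul_vec b (N := k + l + 1) (hP1 _ _)
      (FiliformLie.P_lie_eq_zero (by omega) hz12 h12 h1 hbp hbq _ k l rfl hln hkl.le)).symm.trans ?_
    rw [FiliformLie.sum_Icc_succ_eq_add_sum (by omega), add_comm]
    refine congrArg₂ (· + ·) (Finset.sum_congr rfl fun h hh => ?_) rfl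
    rw [FiliformLie.P_lie_vec_one h12 h1 (Finset.mem_Icc.1 hh).1]
  · rcases hor with h | h
    · exact hbp _ _ hi (by omega) h (by omega) hjn
    · exact hbq _ _ hi (by omega) (by omega) h
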